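/- Let $E$ be a complex Banach space and let $\mathscr{L}(E)$ be the space of bounded linear operators on $E$. An operator $T\in\mathscr{L}(E)$ is called *power-bounded* if $\sup_{n\in\mathbb N}\|T^n\|<\infty$; *power-bounded below* if $\inf_{n\in\mathbb N}\|T^nx\|>0$ for every $x\in E\setminus\{0\}$; and *doubly power-bounded* if $T$ is invertible and both $T$ and $T^{-1}$ are power-bounded. For $D\subseteq E$, we say that $T$ *has relatively compact orbits on $D$* if for every $x\in D$ the orbit $\{T^nx \mid n\in\mathbb N\}$ has compact closure in $E$. A power-bounded operator $T$ is called *mean ergodic on $E$* if $E=\operatorname{fix}(T)\oplus\overline{\operatorname{rg}(I-T)}$, where $\operatorname{fix}(T)=\{x\in E\mid Tx=x\}$. The space $E$ *contains a copy of $c_0$* if some closed linear subspace of $E$ is isomorphic, as a topological vector space, to the Banach space $c_0$ of complex null sequences with the supremum norm. Consider the following assertions. (a) $E$ does not contain a copy of $c_0$. (b) Every power-bounded operator $T\in\mathscr{L}(E)$ which is power-bounded below and has relatively compact orbits on $\operatorname{rg}(I-T)$ has relatively compact orbits on $E$. (c) Every power-bounded operator $T\in\mathscr{L}(E)$ which is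 power-bounded below and has relatively compact orbits on $\operatorname{rg}(I-T)$ is mean ergodic on $E$. (d) Every doubly power-bounded operator $T\in\mathscr{L}(E)$ with relatively compact orbits on $\operatorname{rg}(I-T)$ has relatively compact orbits on $E$. (e) Every doubly power-bounded operator $T\in\mathscr{L}(E)$ with relatively compact orbits on $\operatorname{rg}(I-T)$ is mean ergodic on $E$. Then (a) $\Rightarrow$ (b) $\Leftrightarrow$ (c) $\Rightarrow$ (d) $\Leftrightarrow$ (e). If $E$ is separable, then all five assertions are equivalent. -/

import Mathlib

open scoped ZeroAtInfty

namespace OrbitCompactness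

variable {E : Type*} [NormedAddCommGroup E] [NormedSpace ℂ E]

/-- `E` contains a copy of `c₀`: some linear subspace of `E` is isomorphic (as a topological
vector space) to the Banach space `C₀(ℕ, ℂ)` of complex null sequences with the supremum norm.
Such a subspace is complete, hence automatically closed in `E`. -/
def ContainsCopyOfC0 (E : Type*) [NormedAddCommGroup E] [NormedSpace ℂ E] : Prop :=
  ∃ F : Submodule ℂ E, Nonempty (C₀(ℕ, ℂ) ≃L[ℂ] F)

/-- `T` is power-bounded: the powers `T ^ n` are uniformly bounded in operator norm. -/
def PowerBounded (T : E →L[ℂ] E) : Prop :=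
  ∃ C : ℝ, ∀ n : ℕ, ‖T ^ n‖ ≤ C

/-- `T` is power-bounded below: for each `x ≠ 0` the infimum of the numbers `‖T ^ n x‖` is
positive. -/
def PowerBoundedBelow (T : E →L[ℂ] E) : Prop :=
  ∀ x : E, x ≠ 0 → ∃ c : ℝ, 0 < c ∧ ∀ n : ℕ, c ≤ ‖(T ^ n) x‖

/-- `T` is doubly power-bounded: `T` is invertible and both `T` and its inverse are
power-bounded. -/
def DoublyPowerBounded (T : E →L[ℂ] E) : Prop :=
  ∃ R : E →L[ℂ] E, T * R = 1 ∧ R * T = 1 ∧ PowerBounded T ∧ PowerBounded R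

/-- The orbit `{T ^ n x | n ∈ ℕ}`. -/
def orbit (T : E →L[ℂ] E) (x : E) : Set E :=
  Set.range fun n : ℕ => (T ^ n) x

/-- `T` has relatively compact orbits on the set `D`: the orbit of each element of `D` has
compact closure in `E`. -/
def RelCompactOrbitsOn (T : E →L[ℂ] E) (D : Set E) : Prop :=
  ∀ x ∈ D, IsCompact (closure (orbit T x))

/-- `T` has relatively compact orbits on `E`, that is, `T` is almost periodic. -/
def AlmostPeriodic (T : E →L[ℂ] E) : Prop :=
  RelCompactOrbitsOn T Set.univ

/-- The range of `I - T`. -/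
def rangeIdSub (T : E →L[ℂ] E) : Set E :=
  Set.range fun x : E => x - T x

/-- The space `fix(𝒮)` of common fixed vectors of a set `𝒮` of operators. -/
def fixSpace (𝒮 : Set (E →L[ℂ] E)) : Submodule ℂ E where
  carrier := {x | ∀ S ∈ 𝒮, S x = x}
  zero_mem' := fun S _ => map_zero S
  add_mem' := fun hx hy S hS => by rw [map_add, hx S hS, hy S hS]
  smul_mem' := fun c _ hx S hS => by rw [map_smul, hx S hS]

/-- The space `rg(I - 𝒮)`: the linear span of the union of the ranges of `I - S`, `S ∈ 𝒮`. -/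
def rangeSpan (𝒮 : Set (E →L[ℂ] E)) : Submodule ℂ E :=
  Submodule.span ℂ (⋃ S ∈ 𝒮, rangeIdSub S)

/-- A (bounded, abelian) operator semigroup `𝒮` is mean ergodic: `E` is the direct sum of
`fix(𝒮)` and the closure of `rg(I - 𝒮)`. -/
def MeanErgodicSemigroup (𝒮 : Set (E →L[ℂ] E)) : Prop :=
  IsCompl (fixSpace 𝒮) (rangeSpan 𝒮).topologicalClosure

/-- An operator `T` is mean ergodic if the cyclic semigroup `{T ^ n | n ∈ ℕ}` is. -/
def MeanErgodic (T : E →L[ℂ] E) : Prop :=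
  MeanErgodicSemigroup (Set.range fun n : ℕ => T ^ n)

/-- `E` does not contain a copy of `c₀`. -/
def AssertionA (E : Type*) [NormedAddCommGroup E] [NormedSpace ℂ E] : Prop :=
  ¬ ContainsCopyOfC0 E

/-- Every power-bounded `T` that is power-bounded below and has relatively compact orbits on
`rg(I - T)` has relatively compact orbits on `E`. -/
def AssertionB (E : Type*) [NormedAddCommGroup E] [NormedSpace ℂ E] : Prop :=
  ∀ T : E →L[ℂ] E, PowerBounded T → PowerBoundedBelow T →
    RelCompactOrbitsOn T (rangeIdSub T) → AlmostPeriodic T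

/-- Every power-bounded `T` that is power-bounded below and has relatively compact orbits on
`rg(I - T)` is mean ergodic on `E`. -/
def AssertionC (E : Type*) [NormedAddCommGroup E] [NormedSpace ℂ E] : Prop :=
  ∀ T : E →L[ℂ] E, PowerBounded T → PowerBoundedBelow T →
    RelCompactOrbitsOn T (rangeIdSub T) → MeanErgodic T

/-- Every doubly power-bounded `T` with relatively compact orbits on `rg(I - T)` has relatively
compact orbits on `E`. -/
def AssertionD (E : Type*) [NormedAddCommGroup E] [NormedSpace ℂ E] : Prop :=
  ∀ T : E →L[ℂ] E, DoublyPowerBounded T →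
    RelCompactOrbitsOn T (rangeIdSub T) → AlmostPeriodic T

/-- Every doubly power-bounded `T` with relatively compact orbits on `rg(I - T)` is mean ergodic
on `E`. -/
def AssertionE (E : Type*) [NormedAddCommGroup E] [NormedSpace ℂ E] : Prop :=
  ∀ T : E →L[ℂ] E, DoublyPowerBounded T →
    RelCompactOrbitsOn T (rangeIdSub T) → MeanErgodic T

end OrbitCompactness

namespace OrbitCompactness

open Filter Topology

variable {E : Type*} [NormedAddCommGroup E] [NormedSpace ℂ E]

theorem PowerBounded.exists_bound {T : E →L[ℂ] E} (hT : PowerBounded T) :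
    ∃ C : ℝ, 0 < C ∧ ∀ (n : ℕ) (x : E), ‖(T ^ n) x‖ ≤ C * ‖x‖ := by
  obtain ⟨C, hC⟩ := hT
  refine ⟨max C 1, by positivity, fun n x => (T ^ n).le_of_opNorm_le ?_ x⟩
  exact (hC n).trans (le_max_left _ _)

theorem pow_add_apply (T : E →L[ℂ] E) (m n : ℕ) (x : E) :
    (T ^ (m + n)) x = (T ^ m) ((T ^ n) x) := by
  rw [pow_add, mul_apply_eq_comp]

theorem pow_comm_apply (T : E →L[ℂ] E) (n : ℕ) (x : E) :
    (T ^ n) (T x) = T ((T ^ n) x) := by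
  rw [← mul_apply_eq_comp, ← mul_apply_eq_comp, ← pow_succ, ← pow_succ']

theorem pow_mem_orbit (T : E →L[ℂ] E) (x : E) (n : ℕ) : (T ^ n) x ∈ orbit T x :=
  Set.mem_range_self n

theorem isCompact_closure_orbit_add {T : E →L[ℂ] E} {x y : E}
    (hx : IsCompact (closure (orbit T x))) (hy : IsCompact (closure (orbit T y))) :
    IsCompact (closure (orbit T (x + y))) := by
  refine ((hx.prod hy).image continuous_add).closure_of_subset ?_
  rintro _ ⟨n, rfl⟩
  exact ⟨((T ^ n) x, (T ^ n) y),
    ⟨subset_closure (pow_mem_orbit T x n), subset_closure (pow_mem_orbit T y n)⟩,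
    (map_add (T ^ n) x y).symm⟩

theorem isCompact_closure_orbit_map {T S : E →L[ℂ] E} (hS : Commute S T) {x : E}
    (hx : IsCompact (closure (orbit T x))) : IsCompact (closure (orbit T (S x))) := by
  refine (hx.image S.continuous).closure_of_subset ?_
  rintro _ ⟨n, rfl⟩
  refine ⟨(T ^ n) x, subset_closure (pow_mem_orbit T x n), ?_⟩
  rw [← mul_apply_eq_comp, (hS.pow_right n).eq, mul_apply_eq_comp]

theorem isCompact_closure_orbit_of_isFixed {T : E →L[ℂ] E} {x : E} (hx : T x = x) :
    IsCompact (closure (orbit T x)) := by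
  refine (isCompact_singleton (x := x)).closure_of_subset ?_
  rintro _ ⟨n, rfl⟩
  induction n with
  | zero => simp
  | succ n ih =>
    simp only [Set.mem_singleton_iff] at ih ⊢
    rw [pow_succ, mul_apply_eq_comp, hx, ih]

theorem isCompact_closure_orbit_iff [CompleteSpace E] {T : E →L[ℂ] E} {x : E} :
    IsCompact (closure (orbit T x)) ↔ TotallyBounded (orbit T x) :=
  ⟨fun h => h.totallyBounded.subset subset_closure,
    fun h => h.closure.isCompact_of_isClosed isClosed_closure⟩

/-- The subspace of vectors whose orbit is relatively compact. -/
def apSubmodule (T : E →L[ℂ] E) : Submodule ℂ E where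
  carrier := {x | IsCompact (closure (orbit T x))}
  zero_mem' := isCompact_closure_orbit_of_isFixed (map_zero T)
  add_mem' := isCompact_closure_orbit_add
  smul_mem' c x hx := by
    have hc : Commute (c • (1 : E →L[ℂ] E)) T := (Commute.one_left T).smul_left c
    simpa using isCompact_closure_orbit_map hc hx

theorem mem_apSubmodule {T : E →L[ℂ] E} {x : E} :
    x ∈ apSubmodule T ↔ IsCompact (closure (orbit T x)) := Iff.rfl

theorem almostPeriodic_iff {T : E →L[ℂ] E} : AlmostPeriodic T ↔ apSubmodule T = ⊤ := by
  simp [AlmostPeriodic, RelCompactOrbitsOn, Submodule.eq_top_iff', mem_apSubmodule]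

theorem isClosed_apSubmodule [CompleteSpace E] {T : E →L[ℂ] E} (hT : PowerBounded T) :
    IsClosed (apSubmodule T : Set E) := by
  obtain ⟨C, hC0, hC⟩ := hT.exists_bound
  refine isClosed_of_closure_subset fun x hx => ?_
  rw [SetLike.mem_coe, mem_apSubmodule, isCompact_closure_orbit_iff, Metric.totallyBounded_iff]
  intro ε hε
  obtain ⟨y, hy, hxy⟩ := Metric.mem_closure_iff.1 hx (ε / 2 / C) (by positivity)
  rw [SetLike.mem_coe, mem_apSubmodule, isCompact_closure_orbit_iff,
    Metric.totallyBounded_iff] at hy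
  obtain ⟨t, ht, hcov⟩ := hy (ε / 2) (by positivity)
  refine ⟨t, ht, ?_⟩
  rintro _ ⟨n, rfl⟩
  obtain ⟨z, hz, hzn⟩ := Set.mem_iUnion₂.1 (hcov (pow_mem_orbit T y n))
  refine Set.mem_iUnion₂.2 ⟨z, hz, ?_⟩
  rw [Metric.mem_ball] at hzn ⊢
  have h1 : dist ((T ^ n) x) ((T ^ n) y) < ε / 2 := by
    rw [dist_eq_norm, ← map_sub]
    rw [dist_eq_norm, lt_div_iff₀ hC0] at hxy
    linarith [hC n (x - y)]
  linarith [dist_triangle ((T ^ n) x) ((T ^ n) y) z]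

theorem mem_fixSpace_powers {T : E →L[ℂ] E} {x : E} :
    x ∈ fixSpace (Set.range fun n : ℕ => T ^ n) ↔ T x = x := by
  constructor
  · intro h
    simpa using h (T ^ 1) ⟨1, rfl⟩
  · rintro h _ ⟨n, rfl⟩
    induction n with
    | zero => simp
    | succ n ih =>
      simp only at ih ⊢
      rw [pow_succ, mul_apply_eq_comp, h, ih]

theorem sub_pow_eq (T : E →L[ℂ] E) (x : E) (n : ℕ) :
    x - (T ^ n) x =
      (∑ i ∈ Finset.range n, (T ^ i) x) - T (∑ i ∈ Finset.range n, (T ^ i) x) := by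
  induction n with
  | zero => simp
  | succ n ih =>
    rw [Finset.sum_range_succ, map_add, add_sub_add_comm, ← ih, pow_succ',
      mul_apply_eq_comp]
    abel

theorem coe_range_one_sub (T : E →L[ℂ] E) :
    ((1 - T : E →L[ℂ] E).range : Set E) = rangeIdSub T := by
  ext x
  simp [rangeIdSub]

theorem rangeSpan_powers (T : E →L[ℂ] E) :
    rangeSpan (Set.range fun n : ℕ => T ^ n) = (1 - T : E →L[ℂ] E).range := by
  apply le_antisymm
  · refine Submodule.span_le.2 (Set.iUnion₂_subset ?_)
    rintro _ ⟨n, rfl⟩ _ ⟨x, rfl⟩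
    rw [coe_range_one_sub]
    exact ⟨_, (sub_pow_eq T x n).symm⟩
  · intro x hx
    rw [← SetLike.mem_coe, coe_range_one_sub] at hx
    refine Submodule.subset_span (Set.mem_iUnion₂.2 ⟨T ^ 1, ⟨1, rfl⟩, ?_⟩)
    simpa using hx

/-- A mean ergodic operator with relatively compact orbits on `rg(I - T)` has relatively compact
orbits everywhere. -/
theorem MeanErgodic.almostPeriodic [CompleteSpace E] {T : E →L[ℂ] E} (hT : PowerBounded T)
    (hr : RelCompactOrbitsOn T (rangeIdSub T)) (h : MeanErgodic T) : AlmostPeriodic T := by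
  rw [almostPeriodic_iff, eq_top_iff, ← h.sup_eq_top]
  refine sup_le (fun x hx => isCompact_closure_orbit_of_isFixed (mem_fixSpace_powers.1 hx)) ?_
  refine Submodule.topologicalClosure_minimal _ ?_ (isClosed_apSubmodule hT)
  intro x hx
  rw [rangeSpan_powers, ← SetLike.mem_coe, coe_range_one_sub] at hx
  exact hr x hx

/-- The Cesàro means of the powers of `T`. -/
noncomputable def cesaro (T : E →L[ℂ] E) (n : ℕ) (x : E) : E :=
  (n + 1 : ℝ)⁻¹ • ∑ i ∈ Finset.range (n + 1), (T ^ i) x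

theorem cesaro_of_isFixed {T : E →L[ℂ] E} {x : E} (hx : T x = x) (n : ℕ) : cesaro T n x = x := by
  have h : ∀ i, (T ^ i) x = x := fun i => mem_fixSpace_powers.2 hx (T ^ i) ⟨i, rfl⟩
  have hn : ((n : ℝ) + 1) ≠ 0 := by positivity
  simp only [cesaro, h, Finset.sum_const, Finset.card_range, ← Nat.cast_smul_eq_nsmul ℝ, smul_smul]
  rw [Nat.cast_add_one, inv_mul_cancel₀ hn, one_smul]

theorem cesaro_sub (T : E →L[ℂ] E) (n : ℕ) (x y : E) :
    cesaro T n (x - y) = cesaro T n x - cesaro T n y := by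
  simp [cesaro, Finset.sum_sub_distrib, smul_sub]

theorem map_cesaro (T : E →L[ℂ] E) (n : ℕ) (x : E) : T (cesaro T n x) = cesaro T n (T x) := by
  rw [cesaro, cesaro, T.map_smul_of_tower]
  simp only [map_sum, pow_comm_apply]

theorem norm_cesaro_le {T : E →L[ℂ] E} {C : ℝ} (hC : ∀ (n : ℕ) (x : E), ‖(T ^ n) x‖ ≤ C * ‖x‖)
    (n : ℕ) (x : E) : ‖cesaro T n x‖ ≤ C * ‖x‖ := by
  have hn : (0 : ℝ) < n + 1 := by positivity
  rw [cesaro, norm_smul, Real.norm_of_nonneg (by positivity), inv_mul_le_iff₀ hn]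
  refine (norm_sum_le_of_le _ fun i _ => hC i x).trans ?_
  simp

theorem tendsto_cesaro_sub {T : E →L[ℂ] E} (hT : PowerBounded T) (x : E) :
    Tendsto (fun n => cesaro T n (x - T x)) atTop (𝓝 0) := by
  obtain ⟨C, hC0, hC⟩ := hT.exists_bound
  have h : ∀ n : ℕ, ‖cesaro T n (x - T x)‖ ≤ (‖x‖ + C * ‖x‖) * (1 / ((n : ℝ) + 1)) := by
    intro n
    have : ∑ i ∈ Finset.range (n + 1), (T ^ i) (x - T x) = x - (T ^ (n + 1)) x := by
      rw [sub_pow_eq, map_sum, ← Finset.sum_sub_distrib]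
      simp only [map_sub, pow_comm_apply]
    rw [cesaro, this, norm_smul, Real.norm_of_nonneg (by positivity), mul_comm, one_div]
    gcongr
    exact (norm_sub_le _ _).trans (by gcongr; exact hC _ _)
  refine squeeze_zero_norm h ?_
  simpa using (tendsto_one_div_add_atTop_nhds_zero_nat (𝕜 := ℝ)).const_mul (‖x‖ + C * ‖x‖)

theorem tendsto_cesaro_of_mem_closure {T : E →L[ℂ] E} (hT : PowerBounded T) {x : E}
    (hx : x ∈ closure (rangeIdSub T)) : Tendsto (fun n => cesaro T n x) atTop (𝓝 0) := by
  obtain ⟨C, hC0, hC⟩ := hT.exists_bound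
  rw [Metric.tendsto_atTop]
  intro ε hε
  obtain ⟨_, ⟨y, rfl⟩, hxy⟩ := Metric.mem_closure_iff.1 hx (ε / 2 / C) (by positivity)
  obtain ⟨N, hN⟩ := Metric.tendsto_atTop.1 (tendsto_cesaro_sub hT y) (ε / 2) (by positivity)
  refine ⟨N, fun n hn => ?_⟩
  have h1 := hN n hn
  have h2 := norm_cesaro_le hC n (x - (y - T y))
  rw [dist_eq_norm, lt_div_iff₀ hC0] at hxy
  rw [dist_zero_right] at h1 ⊢
  rw [cesaro_sub] at h2
  calc ‖cesaro T n x‖ ≤ ‖cesaro T n x - cesaro T n (y - T y)‖ + ‖cesaro T n (y - T y)‖ := by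
        simpa using norm_add_le (cesaro T n x - cesaro T n (y - T y)) (cesaro T n (y - T y))
    _ < ε := by linarith

theorem cesaro_mem_convexHull (T : E →L[ℂ] E) (n : ℕ) (x : E) :
    cesaro T n x ∈ convexHull ℝ (orbit T x) := by
  rw [cesaro, Finset.smul_sum]
  refine (convex_convexHull ℝ (orbit T x)).sum_mem (fun i _ => by positivity) ?_
    fun i _ => subset_convexHull ℝ _ (pow_mem_orbit T x i)
  have hn : ((n : ℝ) + 1) ≠ 0 := by positivity
  simp [mul_inv_cancel₀ hn]

theorem sub_cesaro_mem (T : E →L[ℂ] E) (n : ℕ) (x : E) :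
    x - cesaro T n x ∈ (1 - T : E →L[ℂ] E).range := by
  have hn : ((n : ℂ) + 1) ≠ 0 := by exact_mod_cast Nat.succ_ne_zero n
  have h : x - cesaro T n x =
      (n + 1 : ℂ)⁻¹ • ∑ i ∈ Finset.range (n + 1), (x - (T ^ i) x) := by
    have : ((n : ℝ) + 1)⁻¹ • ∑ i ∈ Finset.range (n + 1), (T ^ i) x =
        (n + 1 : ℂ)⁻¹ • ∑ i ∈ Finset.range (n + 1), (T ^ i) x := by
      rw [← Complex.coe_smul]
      norm_num
    rw [cesaro, this, Finset.sum_sub_distrib, smul_sub, Finset.sum_const, Finset.card_range,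
      ← Nat.cast_smul_eq_nsmul ℂ, smul_smul, Nat.cast_add_one, inv_mul_cancel₀ hn, one_smul]
  rw [h]
  refine Submodule.smul_mem _ _ (Submodule.sum_mem _ fun i _ => ?_)
  rw [← SetLike.mem_coe, coe_range_one_sub]
  exact ⟨_, (sub_pow_eq T x i).symm⟩

/-- The mean ergodic theorem for power-bounded operators with relatively compact orbits. -/
theorem AlmostPeriodic.meanErgodic [CompleteSpace E] {T : E →L[ℂ] E} (hT : PowerBounded T)
    (h : AlmostPeriodic T) : MeanErgodic T := by
  have hcl : ∀ x : E, x ∈ (1 - T : E →L[ℂ] E).range.topologicalClosure ↔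
      x ∈ closure (rangeIdSub T) := fun x => by
    rw [← SetLike.mem_coe, Submodule.topologicalClosure_coe, coe_range_one_sub]
  rw [MeanErgodic, MeanErgodicSemigroup, rangeSpan_powers]
  constructor
  · rw [Submodule.disjoint_def]
    intro x hx hx'
    have h1 := tendsto_cesaro_of_mem_closure hT ((hcl x).1 hx')
    simp only [cesaro_of_isFixed (mem_fixSpace_powers.1 hx)] at h1
    exact tendsto_nhds_unique tendsto_const_nhds h1
  · rw [codisjoint_iff, eq_top_iff]
    intro x _
    have hK : IsCompact (closure (convexHull ℝ (orbit T x))) :=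
      (((isCompact_closure_orbit_iff.1 (h x trivial)).convexHull).closure).isCompact_of_isClosed
        isClosed_closure
    obtain ⟨u, -, φ, hφ, hu⟩ :=
      hK.tendsto_subseq fun n => subset_closure (cesaro_mem_convexHull T n x)
    have hTu : T u = u := by
      have h1 := (tendsto_cesaro_sub hT x).comp hφ.tendsto_atTop
      have h2 := hu.sub ((T.continuous.tendsto u).comp hu)
      refine (sub_eq_zero.1 (tendsto_nhds_unique h2 (h1.congr fun n => ?_))).symm
      simp [cesaro_sub, map_cesaro]
    have hv : x - u ∈ (1 - T : E →L[ℂ] E).range.topologicalClosure :=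
      mem_closure_of_tendsto (hu.const_sub x)
        (Eventually.of_forall fun n => sub_cesaro_mem T (φ n) x)
    have : x = u + (x - u) := by abel
    rw [this]
    exact Submodule.add_mem_sup (mem_fixSpace_powers.2 hTu) hv

theorem DoublyPowerBounded.powerBounded {T : E →L[ℂ] E} (h : DoublyPowerBounded T) :
    PowerBounded T :=
  let ⟨_, _, _, hT, _⟩ := h
  hT

theorem DoublyPowerBounded.powerBoundedBelow {T : E →L[ℂ] E} (h : DoublyPowerBounded T) :
    PowerBoundedBelow T := by
  obtain ⟨R, hTR, hRT, -, hR⟩ := h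
  obtain ⟨C, hC0, hC⟩ := hR.exists_bound
  refine fun x hx => ⟨‖x‖ / C, by positivity, fun n => ?_⟩
  have hc : Commute R T := hRT.trans hTR.symm
  have : (R ^ n) ((T ^ n) x) = x := by
    rw [← mul_apply_eq_comp, ← hc.mul_pow, hRT, one_pow,
      one_apply_eq_self]
  rw [div_le_iff₀ hC0, mul_comm]
  have h1 := hC n ((T ^ n) x)
  rwa [this] at h1

theorem exists_strictMono_separated [CompleteSpace E] {T : E →L[ℂ] E} {x : E}
    (hx : x ∉ apSubmodule T) :
    ∃ ε > 0, ∃ n : ℕ → ℕ, StrictMono n ∧ ∀ i j, i < j → ε ≤ ‖(T ^ n j) x - (T ^ n i) x‖ := by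
  rw [mem_apSubmodule, isCompact_closure_orbit_iff, Metric.totallyBounded_iff] at hx
  push Not at hx
  obtain ⟨ε, hε, h⟩ := hx
  refine ⟨ε, hε, ?_⟩
  obtain ⟨n, -, hn⟩ := exists_seq_of_forall_finset_exists (fun _ : ℕ => True)
    (fun a b => a < b ∧ ε ≤ ‖(T ^ b) x - (T ^ a) x‖) (fun s _ => by
      set N := s.sup id + 1 with hN
      have hfin : ((fun k : ℕ => (T ^ k) x) '' (Finset.range N : Set ℕ)).Finite :=
        (Finset.finite_toSet _).image _
      obtain ⟨_, ⟨b, rfl⟩, hb⟩ := Set.not_subset.1 (h _ hfin)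
      have hb' : ∀ a < N, ε ≤ ‖(T ^ b) x - (T ^ a) x‖ := fun a ha => by
        by_contra! hlt
        exact hb (Set.mem_iUnion₂.2 ⟨(T ^ a) x, ⟨a, by simpa using ha, rfl⟩,
          by rwa [Metric.mem_ball, dist_eq_norm]⟩)
      have hbN : N ≤ b := by
        by_contra! hlt
        have := hb' b hlt
        simp only [sub_self, norm_zero] at this
        linarith
      refine ⟨b, trivial, fun a ha => ?_⟩
      have haN : a < N := Nat.lt_succ_of_le (Finset.le_sup (f := id) ha)
      exact ⟨haN.trans_le hbN, hb' a haN⟩)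
  exact ⟨n, strictMono_nat_of_lt_succ fun i => (hn i (i + 1) i.lt_succ_self).1,
    fun i j hij => (hn i j hij).2⟩

/-- If the orbit of `x` is not relatively compact, then there are powers of `T` which move `x` by
at least `ε` while almost fixing any prescribed finite family of vectors with relatively compact
orbits. -/
theorem exists_pow_almost_fix [CompleteSpace E] {T : E →L[ℂ] E} (hT : PowerBounded T)
    (hb : PowerBoundedBelow T) {x : E} (hx : x ∉ apSubmodule T) :
    ∃ ε > 0, ∀ (ι : Type) [Fintype ι] (z : ι → E), (∀ a, z a ∈ apSubmodule T) →
      ∀ δ > 0, ∃ m : ℕ, ε ≤ ‖(T ^ m) x - x‖ ∧ ∀ a, ‖(T ^ m) (z a) - z a‖ < δ := by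
  obtain ⟨C, hC0, hC⟩ := hT.exists_bound
  obtain ⟨ε, hε, n, hn, hsep⟩ := exists_strictMono_separated hx
  refine ⟨ε / C, by positivity, fun ι _ z hz δ hδ => ?_⟩
  have hK : IsCompact (Set.univ.pi fun a => closure (orbit T (z a))) :=
    isCompact_univ_pi fun a => hz a
  have hmem : ∀ k : ℕ, (fun a => (T ^ k) (z a)) ∈ Set.univ.pi fun a => closure (orbit T (z a)) :=
    fun k a _ => subset_closure (pow_mem_orbit T (z a) k)
  obtain ⟨w, -, φ, hφ, hw⟩ := hK.tendsto_subseq fun i => hmem (n i)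
  obtain ⟨z', -, ψ, hψ, hz'⟩ := hK.tendsto_subseq fun i => hmem (n (φ (i + 1)) - n (φ i))
  have hadd : ∀ i, n (φ i) + (n (φ (i + 1)) - n (φ i)) = n (φ (i + 1)) := fun i =>
    Nat.add_sub_of_le (hn.monotone (hφ.monotone i.le_succ))
  rw [tendsto_pi_nhds] at hw hz'
  have hfix : ∀ a, z' a = z a := by
    intro a
    by_contra hne
    obtain ⟨c, hc, hlow⟩ := hb _ (sub_ne_zero.2 hne)
    have h1 : Tendsto (fun i => C * ‖z' a - (T ^ (n (φ (ψ i + 1)) - n (φ (ψ i)))) (z a)‖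
        + ‖(T ^ n (φ (ψ i + 1))) (z a) - (T ^ n (φ (ψ i))) (z a)‖) atTop (𝓝 0) := by
      have e1 := (((hz' a).const_sub (z' a)).norm).const_mul C
      have e2 := ((((hw a).comp (tendsto_add_atTop_nat 1)).sub (hw a)).norm).comp
        hψ.tendsto_atTop
      simpa using e1.add e2
    obtain ⟨i, hi⟩ := (h1.eventually_lt_const hc).exists
    have h2 := hlow (n (φ (ψ i)))
    have h3 : (T ^ n (φ (ψ i))) (z' a - z a) =
        (T ^ n (φ (ψ i))) (z' a - (T ^ (n (φ (ψ i + 1)) - n (φ (ψ i)))) (z a)) +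
        ((T ^ n (φ (ψ i + 1))) (z a) - (T ^ n (φ (ψ i))) (z a)) := by
      rw [map_sub, map_sub, ← pow_add_apply, hadd]
      abel
    rw [h3] at h2
    exact absurd (h2.trans (norm_add_le_of_le (hC _ _) le_rfl)) (not_le.2 hi)
  have hev : ∀ᶠ i in atTop, ∀ a,
      ‖(T ^ (n (φ (ψ i + 1)) - n (φ (ψ i)))) (z a) - z a‖ < δ := by
    rw [eventually_all]
    intro a
    have := hz' a
    rw [hfix a, tendsto_iff_norm_sub_tendsto_zero] at this
    exact this.eventually_lt_const hδ
  obtain ⟨i, hi⟩ := hev.exists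
  refine ⟨_, ?_, hi⟩
  have h1 := hsep _ _ (hφ (Nat.lt_succ_self (ψ i)))
  have h2 := hC (n (φ (ψ i))) ((T ^ (n (φ (ψ i + 1)) - n (φ (ψ i)))) x - x)
  rw [map_sub, ← pow_add_apply, hadd] at h2
  rw [div_le_iff₀ hC0, mul_comm]
  exact h1.trans h2

/-- An operator violating the conclusion of assertion (b) gives rise to a seminormalized sequence
whose finite partial sums are bounded. -/
theorem exists_bounded_partial_sums [CompleteSpace E] {T : E →L[ℂ] E} (hT : PowerBounded T)
    (hb : PowerBoundedBelow T) (hr : RelCompactOrbitsOn T (rangeIdSub T)) {x : E}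
    (hx : x ∉ apSubmodule T) :
    ∃ (e : ℕ → E) (ε M : ℝ), 0 < ε ∧ (∀ j, ε ≤ ‖e j‖) ∧ ∀ s : Finset ℕ, ‖∑ i ∈ s, e i‖ ≤ M := by
  obtain ⟨C, hC0, hC⟩ := hT.exists_bound
  obtain ⟨ε, hε, h⟩ := exists_pow_almost_fix hT hb hx
  have hap : ∀ k : ℕ, (T ^ k) x - x ∈ apSubmodule T := fun k => by
    rw [← neg_sub, sub_pow_eq]
    exact neg_mem (hr _ ⟨_, rfl⟩)
  have hex : ∀ (S : Finset ℕ) (j : ℕ), ∃ m : ℕ, ε ≤ ‖(T ^ m) x - x‖ ∧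
      ∀ k ∈ S, ‖(T ^ m) ((T ^ k) x - x) - ((T ^ k) x - x)‖ < (1 / 2) ^ j := fun S j => by
    obtain ⟨m, hm, hm'⟩ := h S (fun k => (T ^ (k : ℕ)) x - x) (fun k => hap k) ((1 / 2) ^ j)
      (by positivity)
    exact ⟨m, hm, fun k hk => hm' ⟨k, hk⟩⟩
  choose m hm hm' using hex
  let S : ℕ → Finset ℕ := fun j =>
    Nat.rec {0} (fun j S => S ∪ S.image (· + m S j)) j
  have hS : ∀ j, S (j + 1) = S j ∪ (S j).image (· + m (S j) j) := fun j => rfl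
  let e : ℕ → E := fun j => (T ^ m (S j) j) x - x
  have key : ∀ j, ∀ F ⊆ Finset.range j, ∃ k ∈ S j,
      ‖(T ^ k) x - x - ∑ i ∈ F, e i‖ ≤ ∑ i ∈ Finset.range j, (1 / 2 : ℝ) ^ i := by
    intro j
    induction j with
    | zero =>
      intro F hF
      obtain rfl : F = ∅ := by simpa using hF
      exact ⟨0, by simp [S], by simp⟩
    | succ j ih =>
      intro F hF
      rw [Finset.sum_range_succ]
      by_cases hj : j ∈ F
      · obtain ⟨k, hk, hle⟩ := ih (F.erase j) (fun i hi => by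
          have h1 := Finset.mem_range.1 (hF (Finset.mem_of_mem_erase hi))
          have h2 := Finset.ne_of_mem_erase hi
          exact Finset.mem_range.2 (by omega))
        refine ⟨k + m (S j) j, ?_, ?_⟩
        · rw [hS]
          exact Finset.mem_union_right _ (Finset.mem_image_of_mem _ hk)
        · have h1 := (hm' (S j) j k hk).le
          rw [← Finset.add_sum_erase F e hj, add_comm k, pow_add_apply]
          have : (T ^ m (S j) j) ((T ^ k) x) - x - (e j + ∑ i ∈ F.erase j, e i) =
              ((T ^ k) x - x - ∑ i ∈ F.erase j, e i) +
              ((T ^ m (S j) j) ((T ^ k) x - x) - ((T ^ k) x - x)) := by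
            simp only [e, map_sub]
            abel
          rw [this]
          exact norm_add_le_of_le hle h1
      · obtain ⟨k, hk, hle⟩ := ih F (fun i hi => by
          have h1 := Finset.mem_range.1 (hF hi)
          have h2 : i ≠ j := fun h => hj (h ▸ hi)
          exact Finset.mem_range.2 (by omega))
        refine ⟨k, ?_, hle.trans (le_add_of_nonneg_right (by positivity))⟩
        rw [hS]
        exact Finset.mem_union_left _ hk
  refine ⟨e, ε, C * ‖x‖ + ‖x‖ + 2, hε, fun j => hm (S j) j, fun s => ?_⟩
  obtain ⟨k, -, hk⟩ := key (s.sup id + 1) s fun i hi =>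
    Finset.mem_range.2 (Nat.lt_succ_of_le (Finset.le_sup (f := id) hi))
  have h1 : ∑ i ∈ Finset.range (s.sup id + 1), (1 / 2 : ℝ) ^ i ≤ 2 := by
    exact (summable_geometric_two.sum_le_tsum _ fun _ _ => by positivity).trans_eq
      tsum_geometric_two
  have h2 := norm_sub_le_of_le (norm_sub_le_of_le (hC k x) (le_refl ‖x‖)) (hk.trans h1)
  simpa using h2

theorem sum_abs_le_of_partial_sums {u : ℕ → ℝ} {K : ℝ} (h : ∀ s : Finset ℕ, |∑ i ∈ s, u i| ≤ K)
    (s : Finset ℕ) : ∑ i ∈ s, |u i| ≤ 2 * K := by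
  rw [← Finset.sum_filter_add_sum_filter_not s (fun i => 0 ≤ u i)]
  have h1 : ∑ i ∈ s with 0 ≤ u i, |u i| = ∑ i ∈ s with 0 ≤ u i, u i :=
    Finset.sum_congr rfl fun i hi => abs_of_nonneg (Finset.mem_filter.1 hi).2
  have h2 : ∑ i ∈ s with ¬ 0 ≤ u i, |u i| = -∑ i ∈ s with ¬ 0 ≤ u i, u i := by
    rw [← Finset.sum_neg_distrib]
    exact Finset.sum_congr rfl fun i hi => abs_of_neg (not_le.1 (Finset.mem_filter.1 hi).2)
  rw [h1, h2]
  linarith [(abs_le.1 (h (s.filter fun i => 0 ≤ u i))).2,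
    (abs_le.1 (h (s.filter fun i => ¬ 0 ≤ u i))).1]

theorem sum_norm_le_of_partial_sums {e : ℕ → E} {M : ℝ} (h : ∀ s : Finset ℕ, ‖∑ i ∈ s, e i‖ ≤ M)
    {f : StrongDual ℂ E} (hf : ‖f‖ ≤ 1) (s : Finset ℕ) : ∑ i ∈ s, ‖f (e i)‖ ≤ 4 * M := by
  have hM : ∀ t : Finset ℕ, ‖∑ i ∈ t, f (e i)‖ ≤ M := fun t => by
    rw [← map_sum]
    exact ((f.le_of_opNorm_le hf _).trans_eq (one_mul _)).trans (h t)
  have hre := sum_abs_le_of_partial_sums (u := fun i => (f (e i)).re) (K := M) (fun t => by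
    rw [← Complex.re_sum]
    exact (Complex.abs_re_le_norm _).trans (hM t)) s
  have him := sum_abs_le_of_partial_sums (u := fun i => (f (e i)).im) (K := M) (fun t => by
    rw [← Complex.im_sum]
    exact (Complex.abs_im_le_norm _).trans (hM t)) s
  calc ∑ i ∈ s, ‖f (e i)‖ ≤ ∑ i ∈ s, (|(f (e i)).re| + |(f (e i)).im|) :=
        Finset.sum_le_sum fun i _ => Complex.norm_le_abs_re_add_abs_im _
    _ ≤ 4 * M := by
        rw [Finset.sum_add_distrib]
        linarith

/-- The upper `c₀`-estimate with constant `M` for a sequence of vectors. -/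
def C0Bounded (e : ℕ → E) (M : ℝ) : Prop :=
  ∀ (s : Finset ℕ) (a : ℕ → ℂ) (r : ℝ), 0 ≤ r → (∀ n ∈ s, ‖a n‖ ≤ r) → ‖∑ n ∈ s, a n • e n‖ ≤ M * r

theorem c0Bounded_of_partial_sums {e : ℕ → E} {M : ℝ} (h : ∀ s : Finset ℕ, ‖∑ i ∈ s, e i‖ ≤ M) :
    C0Bounded e (4 * M) := by
  intro s a r hr ha
  obtain ⟨f, hf, hfx⟩ := exists_dual_vector'' ℂ (∑ n ∈ s, a n • e n)
  have h1 : ‖∑ n ∈ s, a n • e n‖ = ‖f (∑ n ∈ s, a n • e n)‖ := by rw [hfx]; simp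
  rw [h1, map_sum]
  calc ‖∑ n ∈ s, f (a n • e n)‖ ≤ ∑ n ∈ s, r * ‖f (e n)‖ := by
        refine norm_sum_le_of_le _ fun n hn => ?_
        rw [map_smul, norm_smul]
        exact mul_le_mul_of_nonneg_right (ha n hn) (norm_nonneg _)
    _ ≤ 4 * M * r := by
        rw [← Finset.mul_sum, mul_comm]
        exact mul_le_mul_of_nonneg_right (sum_norm_le_of_partial_sums h hf s) hr

theorem C0Bounded.nonneg {e : ℕ → E} {M : ℝ} (h : C0Bounded e M) : 0 ≤ M := by
  simpa using h ∅ 0 1 zero_le_one (by simp)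

theorem C0Bounded.summable [CompleteSpace E] {e : ℕ → E} {M : ℝ} (h : C0Bounded e M) {a : ℕ → ℂ}
    (ha : Tendsto a atTop (𝓝 0)) : Summable fun n => a n • e n := by
  rw [summable_iff_vanishing_norm]
  intro ε hε
  have hM := h.nonneg
  obtain ⟨N, hN⟩ := Metric.tendsto_atTop.1 ha (ε / (M + 1)) (by positivity)
  refine ⟨Finset.range N, fun t ht => ?_⟩
  refine (h t a (ε / (M + 1)) (by positivity) fun n hn => ?_).trans_lt ?_
  · have : n ∉ Finset.range N := Finset.disjoint_left.1 ht hn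
    have := hN n (by simpa using this)
    rw [dist_zero_right] at this
    exact this.le
  · rw [mul_div_assoc', div_lt_iff₀ (by positivity)]
    nlinarith

theorem C0Bounded.norm_le_of_hasSum {e : ℕ → E} {M : ℝ} (h : C0Bounded e M) {a : ℕ → ℂ} {x : E}
    (hx : HasSum (fun n => a n • e n) x) {r : ℝ} (hr : 0 ≤ r) (ha : ∀ n, ‖a n‖ ≤ r) :
    ‖x‖ ≤ M * r :=
  le_of_tendsto hx.norm (Eventually.of_forall fun s => h s a r hr fun n _ => ha n)

/-- A bounded, pointwise null sequence of functionals defines a bounded operator with values in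
the closed span of a sequence satisfying an upper `c₀`-estimate. -/
theorem C0Bounded.exists_clm [CompleteSpace E] {e : ℕ → E} {M : ℝ} (h : C0Bounded e M)
    {X : Type*} [NormedAddCommGroup X] [NormedSpace ℂ X] {g : ℕ → X →L[ℂ] ℂ} {B : ℝ} (hB : 0 ≤ B)
    (hg : ∀ n x, ‖g n x‖ ≤ B * ‖x‖) (hg0 : ∀ x, Tendsto (fun n => g n x) atTop (𝓝 0)) :
    ∃ S : X →L[ℂ] E, ∀ x, HasSum (fun n => g n x • e n) (S x) := by
  have hs : ∀ x, HasSum (fun n => g n x • e n) (∑' n, g n x • e n) :=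
    fun x => (h.summable (hg0 x)).hasSum
  refine ⟨LinearMap.mkContinuous
    { toFun := fun x => ∑' n, g n x • e n
      map_add' := fun x y => ?_
      map_smul' := fun c x => ?_ } (M * B) fun x => ?_, hs⟩
  · refine HasSum.unique (hs (x + y)) (((hs x).add (hs y)).congr_fun fun n => ?_)
    rw [map_add, add_smul]
  · refine HasSum.unique (hs (c • x)) (((hs x).const_smul c).congr_fun fun n => ?_)
    rw [map_smul, smul_smul, smul_eq_mul]
  · rw [mul_assoc]
    exact h.norm_le_of_hasSum (hs x) (by positivity) fun n => hg n x

/-- Rosenthal's lemma: a nonnegative matrix with uniformly bounded row sums has an infinite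
principal submatrix with small off-diagonal row sums. -/
theorem exists_injective_small_offDiag {η : ℝ} (hη : 0 ≤ η) (N : ℕ) (a : ℕ → ℕ → ℝ)
    (ha : ∀ k j, 0 ≤ a k j)
    (hN : ∀ (k : ℕ) (s : Finset ℕ), k ∉ s → ∑ j ∈ s, a k j ≤ N * η) :
    ∃ φ : ℕ → ℕ, Function.Injective φ ∧
      ∀ (k : ℕ) (s : Finset ℕ), k ∉ s → ∑ j ∈ s, a (φ k) (φ j) ≤ η := by
  induction N generalizing a with
  | zero =>
    refine ⟨id, Function.injective_id, fun k s hk => (hN k s hk).trans ?_⟩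
    simpa using hη
  | succ N ih =>
    have hpair : ∀ p, Function.Injective (Nat.pair p) := fun p i j hij =>
      (Nat.pair_eq_pair.1 hij).2
    by_cases hp : ∃ p, ∀ (k : ℕ) (s : Finset ℕ), k ∉ s →
        ∑ j ∈ s, a (Nat.pair p k) (Nat.pair p j) ≤ η
    · obtain ⟨p, hp⟩ := hp
      exact ⟨Nat.pair p, hpair p, hp⟩
    · push Not at hp
      choose k t hkt hlt using hp
      have hinj : Function.Injective fun p => Nat.pair p (k p) := fun p q hpq =>
        (Nat.pair_eq_pair.1 hpq).1
      obtain ⟨φ, hφ, h⟩ := ih (fun p q => a (Nat.pair p (k p)) (Nat.pair q (k q)))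
        (fun _ _ => ha _ _) fun p s hps => by
          have hdisj : Disjoint (s.map ⟨_, hinj⟩) ((t p).map ⟨_, hpair p⟩) := by
            rw [Finset.disjoint_left]
            rintro _ hq hj
            obtain ⟨q, hqs, rfl⟩ := Finset.mem_map.1 hq
            obtain ⟨j, -, hjq⟩ := Finset.mem_map.1 hj
            exact hps ((Nat.pair_eq_pair.1 hjq).1 ▸ hqs)
          have hnot : Nat.pair p (k p) ∉ (s.map ⟨_, hinj⟩).disjUnion _ hdisj := by
            rw [Finset.mem_disjUnion, not_or]
            constructor
            · intro hq
              obtain ⟨q, hqs, hqp⟩ := Finset.mem_map.1 hq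
              exact hps ((Nat.pair_eq_pair.1 hqp).1 ▸ hqs)
            · intro hj
              obtain ⟨j, hjt, hjq⟩ := Finset.mem_map.1 hj
              exact hkt p ((Nat.pair_eq_pair.1 hjq).2 ▸ hjt)
          have h1 := hN _ _ hnot
          rw [Finset.sum_disjUnion, Finset.sum_map, Finset.sum_map] at h1
          have h2 := hlt p
          simp only [Function.Embedding.coeFn_mk] at h1
          push_cast at h1
          linarith
      exact ⟨fun p => Nat.pair (φ p) (k (φ p)), hinj.comp hφ, h⟩

theorem c0_norm_apply_le (x : C₀(ℕ, ℂ)) (n : ℕ) : ‖x n‖ ≤ ‖x‖ :=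
  x.toBCF.norm_coe_le_norm n

theorem c0_norm_le {x : C₀(ℕ, ℂ)} {r : ℝ} (hr : 0 ≤ r) (h : ∀ n, ‖x n‖ ≤ r) : ‖x‖ ≤ r :=
  (BoundedContinuousFunction.norm_le hr).2 h

/-- The coordinate functionals on `c₀`. -/
noncomputable def c0Eval (n : ℕ) : C₀(ℕ, ℂ) →L[ℂ] ℂ :=
  LinearMap.mkContinuous
    { toFun := fun x => x n
      map_add' := fun _ _ => rfl
      map_smul' := fun _ _ => rfl } 1 fun x => by simpa using c0_norm_apply_le x n

theorem c0Eval_apply (n : ℕ) (x : C₀(ℕ, ℂ)) : c0Eval n x = x n := rfl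

theorem tendsto_c0 (x : C₀(ℕ, ℂ)) : Tendsto x atTop (𝓝 0) := by
  have := x.zero_at_infty'
  rwa [cocompact_eq_cofinite, Nat.cofinite_eq_atTop] at this

/-- The Bessaga–Pełczyński theorem: a seminormalized sequence with bounded finite partial sums
generates a copy of `c₀`. -/
theorem containsCopyOfC0_of_partial_sums [CompleteSpace E] {e : ℕ → E} {ε M : ℝ} (hε : 0 < ε)
    (he : ∀ j, ε ≤ ‖e j‖) (hM : ∀ s : Finset ℕ, ‖∑ i ∈ s, e i‖ ≤ M) : ContainsCopyOfC0 E := by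
  choose f hf hfe using fun j => exists_dual_vector'' ℂ (e j)
  obtain ⟨N, hN⟩ := exists_nat_ge (4 * M / (ε / 2))
  rw [div_le_iff₀ (by positivity)] at hN
  obtain ⟨φ, hφ, hoff⟩ := exists_injective_small_offDiag (η := ε / 2) (by positivity) N
    (fun k j => ‖f k (e j)‖) (fun _ _ => norm_nonneg _)
    fun k s _ => (sum_norm_le_of_partial_sums hM (hf k) s).trans hN
  have hM' : ∀ s : Finset ℕ, ‖∑ i ∈ s, e (φ i)‖ ≤ M := fun s => by
    simpa using hM (s.map ⟨φ, hφ⟩)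
  obtain ⟨J, hJ⟩ := (c0Bounded_of_partial_sums hM').exists_clm (g := c0Eval) zero_le_one
    (fun n x => (c0_norm_apply_le x n).trans_eq (one_mul _).symm) tendsto_c0
  have hlow : ∀ x, (ε / 2) * ‖x‖ ≤ ‖J x‖ := by
    intro x
    have hk : ∀ k, ‖x k‖ ≤ (‖J x‖ + ε / 2 * ‖x‖) / ε := by
      intro k
      rw [le_div_iff₀ hε, ← sub_le_iff_le_add]
      have hlim : Tendsto (fun s : Finset ℕ => ‖∑ i ∈ s, c0Eval i x • e (φ i)‖) atTop
          (𝓝 ‖J x‖) := (hJ x).norm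
      refine ge_of_tendsto hlim ?_
      filter_upwards [eventually_ge_atTop {k}] with s hs
      have hks : k ∈ s := Finset.singleton_subset_iff.1 hs
      have h1 : ‖f (φ k) (∑ i ∈ s, c0Eval i x • e (φ i))‖ ≤ ‖∑ i ∈ s, c0Eval i x • e (φ i)‖ :=
        ((f (φ k)).le_of_opNorm_le (hf _) _).trans_eq (one_mul _)
      refine le_trans ?_ h1
      rw [← Finset.add_sum_erase s _ hks, map_add, map_smul, map_sum, hfe]
      have h2 : ‖∑ i ∈ s.erase k, f (φ k) (c0Eval i x • e (φ i))‖ ≤ ε / 2 * ‖x‖ := by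
        refine (norm_sum_le_of_le (f := fun i => f (φ k) (c0Eval i x • e (φ i)))
          (n := fun i => ‖x‖ * ‖f (φ k) (e (φ i))‖) _ fun i _ => ?_).trans ?_
        · rw [map_smul, norm_smul]
          exact mul_le_mul_of_nonneg_right (c0_norm_apply_le x i) (norm_nonneg _)
        · rw [← Finset.mul_sum, mul_comm]
          exact mul_le_mul_of_nonneg_right (hoff k _ (Finset.notMem_erase k s)) (norm_nonneg _)
      have h3 : ‖x k‖ * ε ≤ ‖c0Eval k x • ((‖e (φ k)‖ : ℝ) : ℂ)‖ := by
        rw [norm_smul, Complex.norm_real, norm_norm, c0Eval_apply]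
        exact mul_le_mul_of_nonneg_left (he _) (norm_nonneg _)
      have h4 := norm_sub_le_norm_add (c0Eval k x • ((‖e (φ k)‖ : ℝ) : ℂ))
        (∑ i ∈ s.erase k, f (φ k) (c0Eval i x • e (φ i)))
      refine le_trans ?_ h4
      linarith
    have := c0_norm_le (by positivity) hk
    rw [le_div_iff₀ hε] at this
    linarith
  have hanti : AntilipschitzWith (Real.toNNReal (ε / 2)⁻¹) J := by
    refine ContinuousLinearMap.antilipschitz_of_bound J fun x => ?_
    rw [Real.coe_toNNReal _ (by positivity), ← div_eq_inv_mul, le_div_iff₀ (by positivity),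
      mul_comm]
    exact hlow x
  exact ⟨_, ⟨J.equivRange hanti.injective (hanti.isClosed_range J.uniformContinuous)⟩⟩

/-- The unit vectors of `c₀`. -/
noncomputable def c0Single (n : ℕ) : C₀(ℕ, ℂ) where
  toFun := Pi.single n 1
  continuous_toFun := continuous_of_discreteTopology
  zero_at_infty' := by
    rw [cocompact_eq_cofinite, Nat.cofinite_eq_atTop]
    refine tendsto_const_nhds.congr' ?_
    filter_upwards [eventually_gt_atTop n] with k hk
    rw [Pi.single_eq_of_ne hk.ne']

theorem c0Single_apply (n k : ℕ) : c0Single n k = if k = n then 1 else 0 :=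
  Pi.single_apply n 1 k

theorem c0Bounded_c0Single : C0Bounded c0Single 1 := by
  intro s a r hr ha
  rw [one_mul]
  refine c0_norm_le hr fun k => ?_
  have : (∑ n ∈ s, a n • c0Single n) k = if k ∈ s then a k else 0 := by
    rw [← c0Eval_apply, map_sum]
    simp [c0Eval_apply, c0Single_apply]
  rw [this]
  split_ifs with hk
  · exact ha k hk
  · simpa using hr

theorem C0Bounded.map {X : Type*} [NormedAddCommGroup X] [NormedSpace ℂ X] {e : ℕ → X} {M : ℝ}
    (h : C0Bounded e M) (J : X →L[ℂ] E) : C0Bounded (fun n => J (e n)) (‖J‖ * M) := by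
  intro s a r hr ha
  simp only [← map_smul, ← map_sum]
  rw [mul_assoc]
  exact (J.le_opNorm _).trans (mul_le_mul_of_nonneg_left (h s a r hr ha) (norm_nonneg _))

theorem C0Bounded.comp_injective {e : ℕ → E} {M : ℝ} (h : C0Bounded e M) {φ : ℕ → ℕ}
    (hφ : Function.Injective φ) : C0Bounded (e ∘ φ) M := by
  intro s a r hr ha
  have h1 := h (s.map ⟨φ, hφ⟩) (a ∘ Function.invFun φ) r hr (by
    simpa [Function.leftInverse_invFun hφ _] using ha)
  simpa [Function.leftInverse_invFun hφ _] using h1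

/-- A copy of `c₀` provides a `c₀`-sequence with bounded biorthogonal functionals. -/
theorem ContainsCopyOfC0.exists_biorthogonal (h : ContainsCopyOfC0 E) :
    ∃ (e : ℕ → E) (f : ℕ → StrongDual ℂ E) (M B : ℝ), C0Bounded e M ∧ (∀ n, ‖f n‖ ≤ B) ∧
      ∀ n m, f n (e m) = if n = m then 1 else 0 := by
  obtain ⟨F, ⟨J⟩⟩ := h
  choose f hf hfn using fun n =>
    exists_extension_norm_eq F ((c0Eval n).comp (J.symm : F →L[ℂ] C₀(ℕ, ℂ)))
  refine ⟨fun n => J (c0Single n), f, _, ‖(J.symm : F →L[ℂ] C₀(ℕ, ℂ))‖,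
    c0Bounded_c0Single.map (F.subtypeL.comp (J : C₀(ℕ, ℂ) →L[ℂ] F)), fun n => ?_, fun n m => ?_⟩
  · rw [hfn]
    refine (ContinuousLinearMap.opNorm_comp_le _ _).trans ?_
    exact mul_le_of_le_one_left (norm_nonneg _) (LinearMap.mkContinuous_norm_le _ zero_le_one _)
  · rw [hf]
    simp [c0Eval_apply, c0Single_apply]

/-- Veech's argument for Sobczyk's theorem: in a separable space, a bounded sequence of functionals
which tends to zero on a given set can be corrected by functionals vanishing on that set to a
weak-* null sequence. -/
theorem exists_weakStar_null_correction [TopologicalSpace.SeparableSpace E] {f : ℕ → StrongDual ℂ E}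
    {B : ℝ} (hB : ∀ n, ‖f n‖ ≤ B) {D : Set E}
    (hD : ∀ x ∈ D, Tendsto (fun n => f n x) atTop (𝓝 0)) :
    ∃ h : ℕ → StrongDual ℂ E, (∀ n, ‖h n‖ ≤ B) ∧ (∀ n, ∀ x ∈ D, h n x = 0) ∧
      ∀ x, Tendsto (fun n => f n x - h n x) atTop (𝓝 0) := by
  have hB0 : 0 ≤ B := (norm_nonneg _).trans (hB 0)
  let X : Set (WeakDual ℂ E) := WeakDual.toStrongDual ⁻¹' Metric.closedBall 0 B
  have hX : IsCompact X := WeakDual.isCompact_closedBall 0 B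
  have hXmem : ∀ g : WeakDual ℂ E, g ∈ X ↔ ‖WeakDual.toStrongDual g‖ ≤ B := fun g => by
    simp [X]
  have : CompactSpace X := isCompact_iff_compactSpace.1 hX
  have := WeakDual.metrizable_of_isCompact ℂ E X hX
  let : MetricSpace X := TopologicalSpace.metrizableSpaceMetric X
  have heval : ∀ x : E, Continuous fun g : X => (g : WeakDual ℂ E) x := fun x =>
    (WeakDual.eval_continuous x).comp continuous_subtype_val
  let K : Set X := {g | ∀ x ∈ D, (g : WeakDual ℂ E) x = 0}
  have hKcl : IsClosed K := by
    have : K = ⋂ x ∈ D, {g : X | (g : WeakDual ℂ E) x = 0} := by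
      ext g
      simp [K]
    rw [this]
    exact isClosed_biInter fun x _ => isClosed_eq (heval x) continuous_const
  have hK0 : K.Nonempty := ⟨⟨0, (hXmem 0).2 (by simpa using hB0)⟩, fun x _ => rfl⟩
  let u : ℕ → X := fun n => ⟨StrongDual.toWeakDual (f n), (hXmem _).2 (hB n)⟩
  choose v hvK hv using fun n => hKcl.isCompact.exists_infDist_eq_dist hK0 (u n)
  have hdist : Tendsto (fun n => dist (u n) (v n)) atTop (𝓝 0) := by
    simp only [← hv]
    refine tendsto_of_subseq_tendsto fun ns hns => ?_
    obtain ⟨w, -, φ, hφ, hw⟩ := isCompact_univ.tendsto_subseq fun n => Set.mem_univ (u (ns n))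
    refine ⟨φ, ?_⟩
    have hwK : w ∈ K := fun x hx =>
      tendsto_nhds_unique (((heval x).tendsto w).comp hw)
        ((hD x hx).comp (hns.comp hφ.tendsto_atTop))
    have := ((Metric.continuous_infDist_pt K).tendsto w).comp hw
    rwa [Metric.infDist_zero_of_mem hwK] at this
  refine ⟨fun n => WeakDual.toStrongDual (v n : WeakDual ℂ E), fun n => (hXmem _).1 (v n).2,
    fun n => hvK n, fun x => ?_⟩
  have huc := CompactSpace.uniformContinuous_of_continuous (heval x)
  have h1 := Tendsto.comp huc
    (tendsto_uniformity_iff_dist_tendsto_zero (f := fun n => (u n, v n)) |>.2 hdist)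
  have h2 := tendsto_uniformity_iff_dist_tendsto_zero.1 h1
  rw [tendsto_zero_iff_norm_tendsto_zero]
  refine h2.congr fun n => ?_
  rw [dist_eq_norm]
  rfl

/-- Sobczyk's theorem in sequential form: the biorthogonal functionals of a copy of `c₀` in a
separable space can be chosen weak-* null. -/
theorem ContainsCopyOfC0.exists_biorthogonal_null [TopologicalSpace.SeparableSpace E]
    (h : ContainsCopyOfC0 E) :
    ∃ (e : ℕ → E) (f : ℕ → StrongDual ℂ E) (M B : ℝ), C0Bounded e M ∧ (∀ n, ‖f n‖ ≤ B) ∧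
      (∀ n m, f n (e m) = if n = m then 1 else 0) ∧
      ∀ x, Tendsto (fun n => f n x) atTop (𝓝 0) := by
  obtain ⟨e, f, M, B, he, hB, hfe⟩ := h.exists_biorthogonal
  obtain ⟨g, hg, hg0, hfg⟩ := exists_weakStar_null_correction hB (D := Set.range e) (by
    rintro _ ⟨m, rfl⟩
    refine tendsto_const_nhds.congr' ?_
    filter_upwards [eventually_gt_atTop m] with n hn
    rw [hfe, if_neg hn.ne'])
  refine ⟨e, fun n => f n - g n, M, B + B, he, fun n => norm_sub_le_of_le (hB n) (hg n),
    fun n m => ?_, fun x => by simpa using hfg x⟩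
  rw [sub_apply, hg0 n _ ⟨m, rfl⟩, sub_zero, hfe]

/-- `T - I` acts diagonally with entries `μ n - 1` along the sequence `e` with respect to the
functionals `g`. -/
def IsDiagonal (e : ℕ → E) (g : ℕ → StrongDual ℂ E) (μ : ℕ → ℂ) (T : E →L[ℂ] E) : Prop :=
  ∀ x, HasSum (fun n => ((μ n - 1) * g n x) • e n) (T x - x)

theorem IsDiagonal.apply_functional {e : ℕ → E} {g : ℕ → StrongDual ℂ E}
    (hge : ∀ n m, g n (e m) = if n = m then 1 else 0) {μ : ℕ → ℂ} {T : E →L[ℂ] E}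
    (hT : IsDiagonal e g μ T) (n : ℕ) (x : E) : g n (T x) = μ n * g n x := by
  have h1 := (g n).hasSum (hT x)
  simp only [map_smul, hge, map_sub, smul_eq_mul] at h1
  have h2 := h1.unique (hasSum_single n fun m hm => by rw [if_neg hm.symm, mul_zero])
  rw [if_pos rfl, mul_one] at h2
  linear_combination h2

theorem IsDiagonal.mul {e : ℕ → E} {g : ℕ → StrongDual ℂ E}
    (hge : ∀ n m, g n (e m) = if n = m then 1 else 0) {μ ν : ℕ → ℂ} {T S : E →L[ℂ] E}
    (hT : IsDiagonal e g μ T) (hS : IsDiagonal e g ν S) : IsDiagonal e g (μ * ν) (T * S) := by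
  intro x
  have h1 := (hT (S x)).add (hS x)
  rw [sub_add_sub_cancel] at h1
  refine h1.congr_fun fun n => ?_
  rw [hS.apply_functional hge, ← add_smul, Pi.mul_apply]
  congr 1
  ring

theorem IsDiagonal.pow {e : ℕ → E} {g : ℕ → StrongDual ℂ E}
    (hge : ∀ n m, g n (e m) = if n = m then 1 else 0) {μ : ℕ → ℂ} {T : E →L[ℂ] E}
    (hT : IsDiagonal e g μ T) (k : ℕ) : IsDiagonal e g (μ ^ k) (T ^ k) := by
  induction k with
  | zero =>
    intro x
    simp
  | succ k ih =>
    rw [pow_succ, pow_succ]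
    exact ih.mul hge hT

theorem IsDiagonal.eq_one {e : ℕ → E} {g : ℕ → StrongDual ℂ E} {T : E →L[ℂ] E}
    (hT : IsDiagonal e g 1 T) : T = 1 := by
  ext x
  have := hT x
  simp only [Pi.one_apply, sub_self, zero_mul, zero_smul] at this
  exact sub_eq_zero.1 (this.unique hasSum_zero)

theorem norm_sub_one_le_two {z : ℂ} (hz : ‖z‖ = 1) : ‖z - 1‖ ≤ 2 := by
  have := norm_sub_le z 1
  rw [hz, norm_one] at this
  linarith

theorem IsDiagonal.powerBounded {e : ℕ → E} {M : ℝ} (he : C0Bounded e M) {g : ℕ → StrongDual ℂ E}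
    {B : ℝ} (hg : ∀ n, ‖g n‖ ≤ B) (hge : ∀ n m, g n (e m) = if n = m then 1 else 0) {μ : ℕ → ℂ}
    (hμ : ∀ n, ‖μ n‖ = 1) {T : E →L[ℂ] E} (hT : IsDiagonal e g μ T) : PowerBounded T := by
  have hB : 0 ≤ B := (norm_nonneg _).trans (hg 0)
  have hM := he.nonneg
  refine ⟨M * (2 * B) + 1, fun k => ContinuousLinearMap.opNorm_le_bound _ (by positivity)
    fun x => ?_⟩
  have h1 := he.norm_le_of_hasSum (hT.pow hge k x) (r := 2 * (B * ‖x‖)) (by positivity) fun n => by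
    rw [norm_mul]
    refine mul_le_mul (norm_sub_one_le_two ?_) ((g n).le_of_opNorm_le (hg n) x) (norm_nonneg _)
      zero_le_two
    rw [Pi.pow_apply, norm_pow, hμ, one_pow]
  calc ‖(T ^ k) x‖ = ‖((T ^ k) x - x) + x‖ := by rw [sub_add_cancel]
    _ ≤ M * (2 * (B * ‖x‖)) + ‖x‖ := norm_add_le_of_le h1 le_rfl
    _ = (M * (2 * B) + 1) * ‖x‖ := by ring

theorem exists_isDiagonal [CompleteSpace E] {e : ℕ → E} {M : ℝ} (he : C0Bounded e M)
    {g : ℕ → StrongDual ℂ E} {B : ℝ} (hg : ∀ n, ‖g n‖ ≤ B) {φ : E → ℂ}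
    (hφ : ∀ x, Tendsto (fun n => g n x) atTop (𝓝 (φ x))) {μ : ℕ → ℂ} (hμ : ∀ n, ‖μ n‖ = 1)
    (hμ1 : Tendsto μ atTop (𝓝 1)) : ∃ T : E →L[ℂ] E, IsDiagonal e g μ T := by
  have hB : 0 ≤ B := (norm_nonneg _).trans (hg 0)
  obtain ⟨S, hS⟩ := he.exists_clm (g := fun n => (μ n - 1) • g n) (B := 2 * B) (by positivity)
    (fun n x => by
      rw [smul_apply, norm_smul, mul_assoc]
      exact mul_le_mul (norm_sub_one_le_two (hμ n)) ((g n).le_of_opNorm_le (hg n) x)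
        (norm_nonneg _) zero_le_two)
    (fun x => by
      have := (hμ1.sub_const 1).mul (hφ x)
      rwa [sub_self, zero_mul] at this)
  refine ⟨1 + S, fun x => ?_⟩
  simpa using hS x

theorem isCompact_closure_orbit_of_eigenvector {T : E →L[ℂ] E} {x : E} {z : ℂ} (hz : ‖z‖ = 1)
    (hx : T x = z • x) : IsCompact (closure (orbit T x)) := by
  have h : ∀ n : ℕ, (T ^ n) x = z ^ n • x := fun n => by
    induction n with
    | zero => simp
    | succ n ih => rw [pow_succ', mul_apply_eq_comp, ih, map_smul, hx, smul_smul, pow_succ]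
  refine ((isCompact_sphere (0 : ℂ) 1).image (continuous_id.smul continuous_const :
    Continuous fun c : ℂ => c • x)).closure_of_subset ?_
  rintro _ ⟨n, rfl⟩
  exact ⟨z ^ n, by simp [hz], (h n).symm⟩

/-- A sequence of unimodular numbers different from `1` which converges to `1`. -/
theorem exists_unimodular_tendsto_one :
    ∃ μ : ℕ → ℂ, (∀ n, ‖μ n‖ = 1) ∧ (∀ n, μ n ≠ 1) ∧ Tendsto μ atTop (𝓝 1) := by
  refine ⟨fun n => Complex.exp (((1 / ((n : ℝ) + 1) : ℝ) : ℂ) * Complex.I),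
    fun n => Complex.norm_exp_ofReal_mul_I _, fun n h => ?_, ?_⟩
  · have h1 := congrArg Complex.im h
    rw [Complex.exp_ofReal_mul_I_im, Complex.one_im] at h1
    have h2 : 1 / ((n : ℝ) + 1) ≤ 1 := by
      rw [div_le_one (by positivity)]
      linarith [(Nat.cast_nonneg n : (0 : ℝ) ≤ n)]
    exact (Real.sin_pos_of_pos_of_lt_pi (by positivity)
      (h2.trans_lt (by linarith [Real.pi_gt_three]))).ne' h1
  · have hc : Continuous fun t : ℝ => Complex.exp ((t : ℂ) * Complex.I) := by fun_prop
    have := (hc.tendsto 0).comp (tendsto_one_div_add_atTop_nhds_zero_nat (𝕜 := ℝ))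
    simpa [Function.comp_def] using this

/-- A `c₀`-sequence whose biorthogonal functionals converge pointwise to a functional `φ ≠ 0`
vanishing on the sequence yields a doubly power-bounded operator with relatively compact orbits on
`rg(I - T)` which is not mean ergodic. -/
theorem not_assertionE_of_biorthogonal [CompleteSpace E] {e : ℕ → E} {M : ℝ} (he : C0Bounded e M)
    {g : ℕ → StrongDual ℂ E} {B : ℝ} (hg : ∀ n, ‖g n‖ ≤ B)
    (hge : ∀ n m, g n (e m) = if n = m then 1 else 0) {φ : StrongDual ℂ E}
    (hφ : ∀ x, Tendsto (fun n => g n x) atTop (𝓝 (φ x))) (hφe : ∀ n, φ (e n) = 0) (hφ0 : φ ≠ 0) :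
    ¬ AssertionE E := by
  obtain ⟨μ, hμ, hμne, hμ1⟩ := exists_unimodular_tendsto_one
  have hν : ∀ n, ‖(starRingEnd (ℕ → ℂ) μ) n‖ = 1 := fun n => by
    rw [Pi.conj_apply, RCLike.norm_conj, hμ]
  have hμν : μ * starRingEnd (ℕ → ℂ) μ = 1 := by
    ext n
    rw [Pi.mul_apply, Pi.conj_apply, Complex.mul_conj', hμ]
    simp
  obtain ⟨T, hT⟩ := exists_isDiagonal he hg hφ hμ hμ1
  obtain ⟨R, hR⟩ := exists_isDiagonal he hg hφ hν (by
    have := (Complex.continuous_conj.tendsto 1).comp hμ1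
    rwa [map_one] at this)
  have hTR : T * R = 1 := by
    have := hT.mul hge hR
    rw [hμν] at this
    exact this.eq_one
  have hRT : R * T = 1 := by
    have := hR.mul hge hT
    rw [mul_comm, hμν] at this
    exact this.eq_one
  have hTpb := hT.powerBounded he hg hge hμ
  have hTe : ∀ m, T (e m) = μ m • e m := fun m => by
    have h1 := (hT (e m)).unique (hasSum_single m fun n hn => by
      rw [hge, if_neg hn, mul_zero, zero_smul])
    rw [hge, if_pos rfl, mul_one, sub_smul, one_smul] at h1
    exact sub_left_injective h1
  have hrange : RelCompactOrbitsOn T (rangeIdSub T) := by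
    rintro _ ⟨x, rfl⟩
    change x - T x ∈ apSubmodule T
    rw [← neg_sub]
    refine neg_mem ((isClosed_apSubmodule hTpb).mem_of_tendsto (hT x)
      (Eventually.of_forall fun s => Submodule.sum_mem _ fun n _ => Submodule.smul_mem _ _ ?_))
    exact isCompact_closure_orbit_of_eigenvector (hμ n) (hTe n)
  intro hE
  have hme := (hE T ⟨R, hTR, hRT, hTpb, hR.powerBounded he hg hge hν⟩ hrange).sup_eq_top
  refine hφ0 (LinearMap.ker_eq_top.1 ?_ |> fun h => ContinuousLinearMap.coe_injective h)
  rw [eq_top_iff, ← hme]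
  refine sup_le (fun x hx => ?_) (Submodule.topologicalClosure_minimal _ ?_ φ.isClosed_ker)
  · have hfix := mem_fixSpace_powers.1 hx
    refine tendsto_nhds_unique (hφ x) (tendsto_const_nhds.congr fun n => ?_)
    have h1 := hT.apply_functional hge n x
    rw [hfix] at h1
    have h2 : (μ n - 1) * g n x = 0 := by linear_combination -h1
    exact ((mul_eq_zero.1 h2).resolve_left (sub_ne_zero.2 (hμne n))).symm
  · intro y hy
    rw [rangeSpan_powers, ← SetLike.mem_coe, coe_range_one_sub] at hy
    obtain ⟨x, rfl⟩ := hy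
    have h1 := φ.hasSum (hT x)
    simp only [map_smul, hφe, smul_zero] at h1
    have h2 := h1.unique hasSum_zero
    change φ (x - T x) = 0
    rw [← neg_sub, map_neg, h2, neg_zero]

theorem ContainsCopyOfC0.not_assertionE [CompleteSpace E] [TopologicalSpace.SeparableSpace E]
    (h : ContainsCopyOfC0 E) : ¬ AssertionE E := by
  obtain ⟨e, f, M, B, he, hB, hfe, hf0⟩ := h.exists_biorthogonal_null
  refine not_assertionE_of_biorthogonal (he.comp_injective Nat.succ_injective)
    (g := fun n => f (n + 1) + f 0) (B := B + B) (φ := f 0)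
    (fun n => norm_add_le_of_le (hB _) (hB _)) (fun n m => ?_) (fun x => ?_) (fun n => ?_) ?_
  · simp [hfe]
  · simpa using ((hf0 x).comp (tendsto_add_atTop_nat 1)).add_const (f 0 x)
  · simp [hfe]
  · intro h0
    have := hfe 0 0
    simp [h0] at this

theorem assertionB_of_assertionA [CompleteSpace E] (h : AssertionA E) : AssertionB E := by
  intro T hT hb hr
  rw [almostPeriodic_iff, Submodule.eq_top_iff']
  intro x
  by_contra hx
  obtain ⟨e, ε, M, hε, he, hM⟩ := exists_bounded_partial_sums hT hb hr hx
  exact h (containsCopyOfC0_of_partial_sums hε he hM)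

theorem assertionB_iff_assertionC [CompleteSpace E] : AssertionB E ↔ AssertionC E :=
  ⟨fun h T hT hb hr => (h T hT hb hr).meanErgodic hT,
    fun h T hT hb hr => (h T hT hb hr).almostPeriodic hT hr⟩

theorem assertionD_iff_assertionE [CompleteSpace E] : AssertionD E ↔ AssertionE E :=
  ⟨fun h T hT hr => (h T hT hr).meanErgodic hT.powerBounded,
    fun h T hT hr => (h T hT hr).almostPeriodic hT.powerBounded hr⟩

theorem assertionD_of_assertionB (h : AssertionB E) : AssertionD E :=
  fun T hT hr => h T hT.powerBounded hT.powerBoundedBelow hr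

end OrbitCompactness

open OrbitCompactness in
theorem theorem4p1 (E : Type*) [NormedAddCommGroup E] [NormedSpace ℂ E] [CompleteSpace E] :
    (OrbitCompactness.AssertionA E → OrbitCompactness.AssertionB E) ∧
    (OrbitCompactness.AssertionB E ↔ OrbitCompactness.AssertionC E) ∧
    (OrbitCompactness.AssertionC E → OrbitCompactness.AssertionD E) ∧
    (OrbitCompactness.AssertionD E ↔ OrbitCompactness.AssertionE E) ∧
    (TopologicalSpace.SeparableSpace E →
      List.TFAE [OrbitCompactness.AssertionA E, OrbitCompactness.AssertionB E,
        OrbitCompactness.AssertionC E, OrbitCompactness.AssertionD E,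
        OrbitCompactness.AssertionE E]) := by
  have hCD : AssertionC E → AssertionD E := fun h =>
    assertionD_of_assertionB (assertionB_iff_assertionC.2 h)
  refine ⟨assertionB_of_assertionA, assertionB_iff_assertionC, hCD, assertionD_iff_assertionE,
    fun _ => ?_⟩
  tfae_have 1 → 2 := assertionB_of_assertionA
  tfae_have 2 ↔ 3 := assertionB_iff_assertionC
  tfae_have 3 → 4 := hCD
  tfae_have 4 ↔ 5 := assertionD_iff_assertionE
  tfae_have 5 → 1 := fun h hc => hc.not_assertionE h
  tfae_finish
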